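/- Let $\mathcal C_-$ (clients) and $\mathcal C_+$ (relays) be finite sets with $M$ and $N$ elements, let $u$ be a virtual client and $v$ a virtual relay, and let $\alpha_{ij}\in\mathbb R$ for $i\in\mathcal C_-\cup\{u\}$, $j\in\mathcal C_+\cup\{v\}$. Let $\epsilon>0$. Consider the following distributed auction algorithm. Each client $i\in\mathcal C_-$ stores its current partner $j_i\in\mathcal C_+\cup\{v\}$, initially $v$, and a vector of local prices $P_i\in\mathbb R^{\mathcal C_+}$, initially $0$; put $[P_i]_v=0$. Each relay $j\in\mathcal C_+$ stores its current client $i_j\in\mathcal C_-\cup\{\emptyset\}$, initially $\emptyset$, and its price $p_j$, initially $\alpha_{uj}$. A client $i$ is *willing to bid* if $j_i=v$ and $v$ does not attain $\theta_i=\max_{j\in\mathcal C_+\cup\{v\}}\{\alpha_{ij}-[P_i]_j\}$. As long as some client is willing to bid, an iteration takes place: * All clients of some nonempty set of clients willing to bid (for instance all of them, or a single one) send requests: each such client $i$ chooses a relay $j_i'$ attaining $\theta_i$, puts $\omega_i=\max_{j\in\mathcal C_+\cup\{v\},\,j\ne j_i'}\{\alpha_{ij}-[P_i]_j\}$, and sends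 the bid $\beta_i=[P_i]_{j_i'}+\theta_i-\omega_i+\epsilon$ to $j_i'$. * Each relay $j$ that receives requests considers a highest bid $\beta_i$ among them. If $\beta_i-p_j\ge\epsilon$, it answers "yes" to $i$ and "no" to its previous client $i_j$ (if any) and to all its other requests, and sets $i_j\gets i$, $p_j\gets\beta_i$; otherwise it answers "no" to all its requests. All these answers contain the latest price $p_j$. * A client that receives "yes" from $j$ sets $j_i\gets j$; a previously connected client that receives "no" sets $j_i\gets v$; every client that receives an answer from $j$ sets $[P_i]_j\gets p_j$. The algorithm terminates when no client sends a request, that is, when no client is willing to bid. Then, for all choices made in the iterations (the set of bidding clients, and ties), the algorithm terminates within $$M N^2\left\lceil \frac{\Delta}{\epsilon}\right\rceil$$ iterations, where $\Delta=\max\alpha_{ij}-\min\alpha_{ij}$, the maximum and the minimum being over $i\in\mathcal C_-$ and $j\in\mathcal C_+\cup\{v\}$ (if $M=0$, no iteration takes place). -/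

import Mathlib

namespace DistributedAuction

/-- The joint memory of all clients (type `C`) and relays (type `R`). In `Option R` the value `none`
is the virtual relay `v` (direct connection to the best access point); in `Option C`, as an index
of the benefits, `none` is the virtual client `u`. -/
structure State (C R : Type*) where
  /-- `j_i`: the relay that client `i` is connected to (`none` is the virtual relay `v`). -/
  assoc : C → Option R
  /-- `[P_i]_j`: the price of relay `j` as stored in client `i`. -/
  localPrice : C → R → ℝ
  /-- `i_j`: the client connected to relay `j` (`none` is "no client"). -/
  holder : R → Option C
  /-- `p_j`: the price stored in relay `j`. -/
  price : R → ℝ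

variable {C R : Type*}

/-- Initialization: `j_i = v`, `P_i = 0`, `i_j = ∅`, `p_j = α_{uj}`. -/
def initialState (α : Option C → Option R → ℝ) : State C R where
  assoc _ := none
  localPrice _ _ := 0
  holder _ := none
  price j := α none (some j)

/-- `α_{ij} - [P_i]_j` for `j` a relay or the virtual relay `v`, whose price is `0`. -/
def netBenefit (α : Option C → Option R → ℝ) (s : State C R) (i : C) : Option R → ℝ
  | none => α (some i) none
  | some j => α (some i) (some j) - s.localPrice i j

/-- `x` attains `max_j {α_{ij} - [P_i]_j}` over the relays together with `v`. -/
def IsBest (α : Option C → Option R → ℝ) (s : State C R) (i : C) (x : Option R) : Prop :=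
  ∀ y : Option R, netBenefit α s i y ≤ netBenefit α s i x

/-- The condition under which client `i` sends a request: `j_i = v`, and `v` does not attain
the maximum. -/
def WantsToBid (α : Option C → Option R → ℝ) (s : State C R) (i : C) : Prop :=
  s.assoc i = none ∧ ¬ IsBest α s i none

/-- The bid `β = [P_i]_j + θ_i - ω_i + ε` of client `i` for its best relay `j`; `θ_i` is the largest
net benefit, `ω_i` the largest one over the alternatives to `j` (which include `v`). -/
noncomputable def bid (α : Option C → Option R → ℝ) (ε : ℝ) (s : State C R) (i : C) (j : R) : ℝ :=
  s.localPrice i j + (⨆ x : Option R, netBenefit α s i x)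
    - (⨆ x : {x : Option R // x ≠ some j}, netBenefit α s i x.1) + ε

/-- What happens in one iteration from the state `s`: a nonempty set of the clients that want to
bid send requests, each to a best relay of its own, and every relay answers. Both extreme cases
are included: all these clients act at once, or only one of them does. -/
structure Round (α : Option C → Option R → ℝ) (ε : ℝ) (s : State C R) where
  /-- the clients that send a request -/
  senders : Set C
  /-- the relay `j_i'` to which a sender `i` sends its request -/
  target : C → R
  /-- the client to which relay `j` answers "yes", if any; all other requests get a "no" -/
  winner : R → Option C
  senders_nonempty : senders.Nonempty
  wantsToBid : ∀ i ∈ senders, WantsToBid α s i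
  target_best : ∀ i ∈ senders, IsBest α s i (some (target i))
  /-- a relay says "yes" only to a highest bid among its requests, and only if that bid exceeds the
  price of the relay by at least `ε` -/
  winner_some : ∀ j i, winner j = some i →
    i ∈ senders ∧ target i = j ∧ ε ≤ bid α ε s i j - s.price j ∧
      ∀ i' ∈ senders, target i' = j → bid α ε s i' j ≤ bid α ε s i j
  /-- a relay says "no" to all its requests only if none of them exceeds the price by `ε` -/
  winner_none : ∀ j, winner j = none →
    ∀ i ∈ senders, target i = j → bid α ε s i j - s.price j < ε

namespace Round

variable {α : Option C → Option R → ℝ} {ε : ℝ} {s : State C R}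

/-- The price of relay `j` after the iteration: the accepted bid, if there is one. -/
noncomputable def newPrice (r : Round α ε s) (j : R) : ℝ :=
  match r.winner j with
  | some i => bid α ε s i j
  | none => s.price j

/-- Client `i` held relay `j` and receives "no" from it, because a new bid was accepted. -/
def Displaced (r : Round α ε s) (i : C) (j : R) : Prop :=
  s.holder j = some i ∧ r.winner j ≠ none

open Classical in
/-- The state after the iteration. Clients that sent a request, and clients that are displaced,
learn the latest price of the relay concerned; a displaced client goes back to `v`. -/
noncomputable def next (r : Round α ε s) : State C R where
  assoc i :=
    if i ∈ r.senders ∧ r.winner (r.target i) = some i then some (r.target i)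
    else if ∃ j, r.Displaced i j then none
    else s.assoc i
  localPrice i j :=
    if (i ∈ r.senders ∧ r.target i = j) ∨ r.Displaced i j then r.newPrice j
    else s.localPrice i j
  holder j := (r.winner j).or (s.holder j)
  price j := r.newPrice j

end Round

/-- The algorithm has terminated: no client sends a request any more. -/
def Terminated (α : Option C → Option R → ℝ) (s : State C R) : Prop :=
  ∀ i, ¬ WantsToBid α s i

/-- `s t` is the state after `t` iterations of some run of the algorithm; the sequence is continued
as a constant one after termination. -/
structure IsRun (α : Option C → Option R → ℝ) (ε : ℝ) (s : ℕ → State C R) : Prop where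
  init : s 0 = initialState α
  step : ∀ t, ¬ Terminated α (s t) → ∃ r : Round α ε (s t), s (t + 1) = r.next
  halt : ∀ t, Terminated α (s t) → s (t + 1) = s t

/-- `Δ = max α_{ij} - min α_{ij}`, over the clients `i` and over the relays and `v` for `j`. -/
noncomputable def spread (α : Option C → Option R → ℝ) : ℝ :=
  (⨆ q : C × Option R, α (some q.1) q.2) - ⨅ q : C × Option R, α (some q.1) q.2

end DistributedAuction

/-!
Every iteration carries at least one request, so it is enough to bound the number `n i j` of requests
that client `i` ever sends to relay `j`.

A request from `i` to `j` is sent only while `[P_i]_j < α_{ij} - α_{iv} ≤ Δ`, and apart from the first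
one it raises `[P_i]_j` by at least `ε`. Indeed the bid is at least `[P_i]_j + ε`, so this is clear if `j`
accepts some bid. Otherwise the price `p_j` told to `i` is larger than `[P_i]_j`; since `[P_i]_j` was
itself told by `j` earlier and `p_j` only changes by steps of at least `ε`, the difference is at least
`ε`. The first request is different because `p_j` may start arbitrarily little above the
initial local price `0`. Hence `n i j ≤ ⌈Δ / ε⌉ + 1`, which is at most `N * ⌈Δ / ε⌉` when `N ≥ 2`
and `Δ > 0`; if `Δ = 0`, no client ever bids.

When `N = 1` the only alternative to the relay `j` is `v`, so the bid is `α_{ij} - α_{iv} + ε` whatever the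
local price is. After one request `[P_i]_j ≥ α_{ij} - α_{iv}`, and `i` never sends another: `n i j ≤ 1`.

The counts and the properties of local prices that support these bounds form the invariant `Ledger`;
`Ledger.exists_next` carries it through an iteration, and `Ledger.sum_le` is the resulting bound.
-/

namespace DistributedAuction

variable {C R : Type*}

/-! ### Bids and the spread -/

lemma le_bid [Finite R] {α : Option C → Option R → ℝ} {s : State C R} {i : C} {j : R} (ε : ℝ)
    (h : IsBest α s i (some j)) : s.localPrice i j + ε ≤ bid α ε s i j := by
  have h1 : netBenefit α s i (some j) ≤ ⨆ x : Option R, netBenefit α s i x :=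
    le_ciSup (Set.finite_range _).bddAbove _
  have : Nonempty {x : Option R // x ≠ some j} := ⟨⟨none, by simp⟩⟩
  have h2 : (⨆ x : {x : Option R // x ≠ some j}, netBenefit α s i x.1) ≤
      netBenefit α s i (some j) := ciSup_le fun x => h x.1
  unfold bid
  linarith

/-- With a single relay the bid does not depend on the local price. -/
lemma bid_eq_of_subsingleton [Subsingleton R] {α : Option C → Option R → ℝ} {s : State C R} {i : C}
    {j : R} (ε : ℝ) (h : IsBest α s i (some j)) :
    bid α ε s i j = α (some i) (some j) - α (some i) none + ε := by
  have h1 : (⨆ x : Option R, netBenefit α s i x) = netBenefit α s i (some j) :=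
    le_antisymm (ciSup_le h) (le_ciSup (Set.finite_range _).bddAbove _)
  have : Nonempty {x : Option R // x ≠ some j} := ⟨⟨none, by simp⟩⟩
  have hx (x : {x : Option R // x ≠ some j}) : x.1 = none := by
    rcases x with ⟨_ | k, hk⟩
    · rfl
    · exact absurd (congrArg some (Subsingleton.elim k j)) hk
  have h2 : (⨆ x : {x : Option R // x ≠ some j}, netBenefit α s i x.1) = α (some i) none := by
    simp [hx, netBenefit]
  rw [bid, h1, h2, netBenefit]
  ring

lemma WantsToBid.localPrice_lt {α : Option C → Option R → ℝ} {s : State C R} {i : C} {j : R}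
    (hw : WantsToBid α s i) (h : IsBest α s i (some j)) :
    s.localPrice i j < α (some i) (some j) - α (some i) none := by
  by_contra! hle
  refine hw.2 fun y => (h y).trans ?_
  simp only [netBenefit]
  linarith

lemma sub_le_spread [Finite C] [Finite R] (α : Option C → Option R → ℝ) (i : C) (x y : Option R) :
    α (some i) x - α (some i) y ≤ spread α :=
  sub_le_sub
    (le_ciSup (f := fun q : C × Option R => α (some q.1) q.2) (Set.finite_range _).bddAbove (i, x))
    (ciInf_le (f := fun q : C × Option R => α (some q.1) q.2) (Set.finite_range _).bddBelow (i, y))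

/-! ### Prices in one iteration -/

namespace Round

variable {α : Option C → Option R → ℝ} {ε : ℝ} {s : State C R} (r : Round α ε s)

lemma add_le_newPrice {j : R} (h : r.winner j ≠ none) : s.price j + ε ≤ r.newPrice j := by
  obtain ⟨i, hi⟩ := Option.ne_none_iff_exists'.1 h
  have := (r.winner_some j i hi).2.2.1
  simp only [newPrice, hi]
  linarith

lemma newPrice_eq {j : R} (h : r.winner j = none) : r.newPrice j = s.price j := by
  simp only [newPrice, h]

/-- A relay that receives a bid either ends up with a price not below it, or keeps its old price,
which the bid exceeds by less than `ε`. -/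
lemma bid_le_newPrice_or {i : C} (hi : i ∈ r.senders) :
    bid α ε s i (r.target i) ≤ r.newPrice (r.target i) ∨
      r.newPrice (r.target i) = s.price (r.target i) ∧
        bid α ε s i (r.target i) < s.price (r.target i) + ε := by
  rcases h : r.winner (r.target i) with _ | k
  · have := r.winner_none _ h i hi rfl
    exact .inr ⟨r.newPrice_eq h, by linarith⟩
  · left
    simp only [newPrice, h]
    exact (r.winner_some _ k h).2.2.2 i hi rfl

lemma localPrice_lt_newPrice [Finite R] (hε : 0 < ε) {i : C} (hi : i ∈ r.senders) :
    s.localPrice i (r.target i) < r.newPrice (r.target i) := by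
  have hb := le_bid ε (r.target_best i hi)
  rcases r.bid_le_newPrice_or hi with h | ⟨h, h'⟩ <;> linarith

end Round

/-! ### Counting requests -/

/-- The local price of relay `j` in client `i` is a price that `j` once had: it is the present one, or
the price has since gone up, by at least `ε`. -/
def Synced (ε : ℝ) (s : State C R) (i : C) (j : R) : Prop :=
  s.localPrice i j = s.price j ∨ s.localPrice i j + ε ≤ s.price j

/-- The invariant of the algorithm: `n i j` counts the requests that client `i` has sent so far to
relay `j`. -/
structure Ledger (α : Option C → Option R → ℝ) (ε : ℝ) (s : State C R) (n : C → R → ℕ) : Prop where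
  nonneg : ∀ i j, 0 ≤ s.localPrice i j
  synced : ∀ i j, n i j ≠ 0 → Synced ε s i j
  le_localPrice : ∀ i j, ((n i j : ℝ) - 1) * ε ≤ s.localPrice i j
  count_le : ∀ i j, n i j ≤ ⌈spread α / ε⌉₊ + 1
  /-- with a single relay, one request is enough to make `v` a best choice for ever -/
  single : Subsingleton R → ∀ i j, n i j ≠ 0 →
    α (some i) (some j) - α (some i) none ≤ s.localPrice i j
  single_count_le : Subsingleton R → ∀ i j, n i j ≤ 1

lemma ledger_initialState (α : Option C → Option R → ℝ) {ε : ℝ} (hε : 0 < ε) :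
    Ledger α ε (initialState α) fun _ _ => 0 where
  nonneg _ _ := le_rfl
  synced _ _ h := absurd rfl h
  le_localPrice _ _ := by simpa [initialState] using hε.le
  count_le _ _ := Nat.zero_le _
  single _ _ _ h := absurd rfl h
  single_count_le _ _ _ := Nat.zero_le _

/-- An iteration preserves the invariant, with counts to which each request of the iteration is
added. -/
lemma Ledger.exists_next [Fintype C] [Fintype R] {α : Option C → Option R → ℝ} {ε : ℝ}
    (hε : 0 < ε) {s : State C R} {n : C → R → ℕ} (L : Ledger α ε s n) (r : Round α ε s) :
    ∃ n', Ledger α ε r.next n' ∧ ∑ i, ∑ j, n i j < ∑ i, ∑ j, n' i j := by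
  classical
  have hprice (j) : r.next.price j = r.newPrice j := rfl
  have hmono (j) : r.newPrice j = s.price j ∨ s.price j + ε ≤ r.newPrice j := by
    by_cases h : r.winner j = none
    · exact .inl (r.newPrice_eq h)
    · exact .inr (r.add_le_newPrice h)
  -- every pair falls under one of: a request, a displacement, no communication
  have htri (i j) : (i ∈ r.senders ∧ r.target i = j ∧ r.next.localPrice i j = r.newPrice j) ∨
      (¬(i ∈ r.senders ∧ r.target i = j) ∧ r.Displaced i j ∧
        r.next.localPrice i j = r.newPrice j) ∨
      (¬(i ∈ r.senders ∧ r.target i = j) ∧ r.next.localPrice i j = s.localPrice i j) := by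
    by_cases h1 : i ∈ r.senders ∧ r.target i = j
    · exact .inl ⟨h1.1, h1.2, by simp [Round.next, h1]⟩
    by_cases h2 : r.Displaced i j
    · exact .inr (.inl ⟨h1, h2, by simp [Round.next, h2]⟩)
    · exact .inr (.inr ⟨h1, by simp only [Round.next, h1, h2, or_self, if_false]⟩)
  -- a local price once told by the relay never goes down
  have hle (i j) (hn : n i j ≠ 0) : s.localPrice i j ≤ r.next.localPrice i j := by
    rcases htri i j with ⟨hi, rfl, h⟩ | ⟨-, -, h⟩ | ⟨-, h⟩
    · exact h ▸ (r.localPrice_lt_newPrice hε hi).le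
    · rw [h]
      rcases L.synced i j hn with h' | h' <;> rcases hmono j with h'' | h'' <;> linarith
    · exact h.ge
  have hnonneg (i j) : 0 ≤ r.next.localPrice i j := by
    rcases htri i j with ⟨hi, rfl, h⟩ | ⟨-, hd, h⟩ | ⟨-, h⟩
    · exact h ▸ (L.nonneg i _).trans (r.localPrice_lt_newPrice hε hi).le
    · obtain ⟨k, hk⟩ := Option.ne_none_iff_exists'.1 hd.2
      obtain ⟨hks, rfl, -⟩ := r.winner_some j k hk
      exact h ▸ (L.nonneg k _).trans (r.localPrice_lt_newPrice hε hks).le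
    · exact h ▸ L.nonneg i j
  have hsynced (i j) (hn : (i ∈ r.senders ∧ r.target i = j) ∨ n i j ≠ 0) :
      Synced ε r.next i j := by
    rcases htri i j with ⟨-, -, h⟩ | ⟨-, -, h⟩ | ⟨h1, h⟩
    · exact .inl h
    · exact .inl h
    · unfold Synced
      rw [h, hprice]
      rcases L.synced i j (hn.resolve_left h1) with h' | h' <;> rcases hmono j with h'' | h''
      · exact .inl (by linarith)
      all_goals exact .inr (by linarith)
  -- a request that is not the first one raises the local price by `ε`
  have hraise (i) (hi : i ∈ r.senders) (hn : n i (r.target i) ≠ 0) :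
      s.localPrice i (r.target i) + ε ≤ r.newPrice (r.target i) := by
    have hb := le_bid ε (r.target_best i hi)
    rcases r.bid_le_newPrice_or hi with h | ⟨h, h'⟩
    · exact hb.trans h
    · rcases L.synced i _ hn with h'' | h'' <;> linarith
  have hlt (i) (hi : i ∈ r.senders) :=
    (r.wantsToBid i hi).localPrice_lt (r.target_best i hi)
  let d : C → R → ℕ := fun i j => if i ∈ r.senders ∧ r.target i = j then 1 else 0
  have hd1 {i j} (h : i ∈ r.senders ∧ r.target i = j) : d i j = 1 := if_pos h
  have hd0 {i j} (h : ¬(i ∈ r.senders ∧ r.target i = j)) : d i j = 0 := if_neg h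
  refine ⟨fun i j => n i j + d i j, ⟨hnonneg, fun i j hn => hsynced i j ?_, fun i j => ?_,
    fun i j => ?_, fun hR i j hn => ?_, fun hR i j => ?_⟩, ?_⟩
  · by_contra! h
    exact hn (by simp [hd0 fun h' => h.1 h'.1 h'.2, h.2])
  · by_cases hc : i ∈ r.senders ∧ r.target i = j
    · rw [hd1 hc]
      obtain ⟨hi, rfl⟩ := hc
      by_cases hn : n i (r.target i) = 0
      · simpa [hn] using hnonneg i _
      · have h1 := L.le_localPrice i (r.target i)
        have h2 := hraise i hi hn
        have h3 : r.next.localPrice i (r.target i) = r.newPrice (r.target i) := by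
          simp [Round.next, hi]
        push_cast
        linarith
    · rw [hd0 hc, add_zero]
      by_cases hn : n i j = 0
      · have := hnonneg i j
        rw [hn]
        push_cast
        linarith
      · exact (L.le_localPrice i j).trans (hle i j hn)
  · by_cases hc : i ∈ r.senders ∧ r.target i = j
    · rw [hd1 hc]
      obtain ⟨hi, rfl⟩ := hc
      have h1 : ((n i (r.target i) : ℝ) - 1) * ε < spread α :=
        (L.le_localPrice i _).trans_lt ((hlt i hi).trans_le (sub_le_spread α i _ _))
      have h2 : (n i (r.target i) : ℝ) < ⌈spread α / ε⌉₊ + 1 := by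
        have := (lt_div_iff₀ hε).2 h1
        have := Nat.le_ceil (spread α / ε)
        linarith
      have h3 : n i (r.target i) < ⌈spread α / ε⌉₊ + 1 := by exact_mod_cast h2
      omega
    · rw [hd0 hc]
      exact L.count_le i j
  · by_cases hc : i ∈ r.senders ∧ r.target i = j
    · obtain ⟨hi, rfl⟩ := hc
      have h1 := bid_eq_of_subsingleton ε (r.target_best i hi)
      have h3 : r.next.localPrice i (r.target i) = r.newPrice (r.target i) := by
        simp [Round.next, hi]
      rcases r.bid_le_newPrice_or hi with h | ⟨h, h'⟩ <;> linarith
    · rw [hd0 hc] at hn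
      exact (L.single hR i j hn).trans (hle i j hn)
  · by_cases hc : i ∈ r.senders ∧ r.target i = j
    · rw [hd1 hc]
      obtain ⟨hi, rfl⟩ := hc
      by_cases hn : n i (r.target i) = 0
      · rw [hn]
      · exact absurd (hlt i hi) (L.single hR i _ hn).not_gt
    · rw [hd0 hc]
      exact L.single_count_le hR i j
  · obtain ⟨k, hk⟩ := r.senders_nonempty
    refine Finset.sum_lt_sum (fun i _ => Finset.sum_le_sum fun j _ => Nat.le_add_right _ _)
      ⟨k, Finset.mem_univ k, Finset.sum_lt_sum (fun j _ => Nat.le_add_right _ _)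
        ⟨r.target k, Finset.mem_univ _, ?_⟩⟩
    simp only [hd1 ⟨hk, rfl⟩]
    exact Nat.lt_succ_self _

lemma Ledger.sum_le [Fintype C] [Fintype R] {α : Option C → Option R → ℝ} {ε : ℝ}
    {s : State C R} {n : C → R → ℕ} (L : Ledger α ε s n) (hc : 0 < ⌈spread α / ε⌉₊) :
    ∑ i, ∑ j, n i j ≤ Fintype.card C * Fintype.card R ^ 2 * ⌈spread α / ε⌉₊ := by
  have key (i j) : n i j ≤ Fintype.card R * ⌈spread α / ε⌉₊ := by
    have : 0 < Fintype.card R := Fintype.card_pos_iff.2 ⟨j⟩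
    rcases le_or_gt (Fintype.card R) 1 with h | h
    · exact (L.single_count_le (Fintype.card_le_one_iff_subsingleton.1 h) i j).trans
        (Nat.mul_pos this hc)
    · have := Nat.mul_le_mul_right ⌈spread α / ε⌉₊ h
      have := L.count_le i j
      omega
  calc ∑ i, ∑ j, n i j
      ≤ ∑ _i : C, ∑ _j : R, Fintype.card R * ⌈spread α / ε⌉₊ :=
        Finset.sum_le_sum fun i _ => Finset.sum_le_sum fun j _ => key i j
    _ = Fintype.card C * Fintype.card R ^ 2 * ⌈spread α / ε⌉₊ := by
        simp only [Finset.sum_const, Finset.card_univ, smul_eq_mul]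
        ring

/-! ### Termination -/

lemma IsRun.exists_ledger [Fintype C] [Fintype R] {α : Option C → Option R → ℝ} {ε : ℝ}
    (hε : 0 < ε) {s : ℕ → State C R} (hs : IsRun α ε s) (t : ℕ)
    (ht : ∀ τ < t, ¬ Terminated α (s τ)) :
    ∃ n, Ledger α ε (s t) n ∧ t ≤ ∑ i, ∑ j, n i j := by
  induction t with
  | zero => exact ⟨_, hs.init ▸ ledger_initialState α hε, Nat.zero_le _⟩
  | succ t ih =>
    obtain ⟨n, L, hn⟩ := ih fun τ hτ => ht τ (by omega)
    obtain ⟨r, hr⟩ := hs.step t (ht t (by omega))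
    obtain ⟨n', L', hn'⟩ := L.exists_next hε r
    exact ⟨n', hr ▸ L', by omega⟩

/-- A client is willing to bid only if its benefits are not all equal, and then `Δ > 0`. -/
lemma ceil_pos_of_not_terminated [Finite C] [Finite R] {α : Option C → Option R → ℝ} {ε : ℝ}
    (hε : 0 < ε) (h : ¬ Terminated α (initialState α)) : 0 < ⌈spread α / ε⌉₊ := by
  simp only [Terminated, not_forall, not_not] at h
  obtain ⟨i, -, hi⟩ := h
  simp only [IsBest, not_forall, not_le] at hi
  obtain ⟨_ | j, hj⟩ := hi
  · exact absurd hj (lt_irrefl _)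
  · have := sub_le_spread α i (some j) none
    simp only [netBenefit, initialState] at hj
    exact Nat.ceil_pos.2 (div_pos (by linarith) hε)

end DistributedAuction

theorem mainTheorem2 {C R : Type*} [Fintype C] [Fintype R]
    (α : Option C → Option R → ℝ) (ε : ℝ) (hε : 0 < ε)
    (s : ℕ → DistributedAuction.State C R) (hs : DistributedAuction.IsRun α ε s) :
    ∃ T : ℕ,
      T ≤ Fintype.card C * Fintype.card R ^ 2 * ⌈DistributedAuction.spread α / ε⌉₊ ∧
        DistributedAuction.Terminated α (s T) := by
  by_contra! h
  obtain ⟨n, L, hn⟩ := hs.exists_ledger hε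
    (Fintype.card C * Fintype.card R ^ 2 * ⌈DistributedAuction.spread α / ε⌉₊ + 1)
    fun τ hτ => h τ (by omega)
  have h0 := h 0 (Nat.zero_le _)
  rw [hs.init] at h0
  have := L.sum_le (DistributedAuction.ceil_pos_of_not_terminated hε h0)
  omega
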